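/- Let $l\ge 3$ be an integer and consider the density evolution of the $(l,3,3)$ MacKay–Neal (MN) code over the binary erasure channel with erasure probability $\epsilon$, $$\boldsymbol x^{(t+1)}=\boldsymbol f(\boldsymbol g(\boldsymbol x^{(t)});\epsilon),\qquad \boldsymbol f(\boldsymbol x;\epsilon)=(x_1^{l-1},\ \epsilon x_2^{2}),\qquad \boldsymbol g(\boldsymbol x)=\bigl(1-(1-x_1)^2(1-x_2)^3,\ 1-(1-x_1)^3(1-x_2)^2\bigr).$$ Its potential function is $$U(\boldsymbol x;\epsilon)=\boldsymbol g(\boldsymbol x)\,\boldsymbol D\,\boldsymbol x^{T}-G(\boldsymbol x)-F(\boldsymbol g(\boldsymbol x);\epsilon),$$ where $\boldsymbol D=\operatorname{diag}(3,3)$, $F(\boldsymbol x;\epsilon)=\frac{3}{l}x_1^{l}+\epsilon x_2^{3}$ and $G(\boldsymbol x)=3x_1+3x_2+(1-x_1)^3(1-x_2)^3-1$. For $x_1\in(0,1)$ put $$x_2(x_1)=1-\left(\frac{1-x_1^{1/(l-1)}}{(1-x_1)^{2}}\right)^{1/3},\qquad \epsilon(x_1)=\frac{x_2(x_1)}{\bigl(1-(1-x_1)^3(1-x_2(x_1))^{2}\bigr)^{2}}.$$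 Then $$U\bigl((x_1,x_2(x_1));\epsilon(x_1)\bigr)>0\qquad\text{for all }x_1\in(0,1).$$ Moreover, the potential is strictly positive at every non-trivial fixed point: if $\epsilon\in[0,1]$ and $\boldsymbol x\in[0,1]^2$ satisfy $\boldsymbol x=\boldsymbol f(\boldsymbol g(\boldsymbol x);\epsilon)$, with $\boldsymbol x\neq(0,0)$ and $\boldsymbol x\neq(1,\epsilon)$, then $U(\boldsymbol x;\epsilon)>0$. -/

import Mathlib

noncomputable section

namespace MNCode

/-- The potential function `U(x; ε) = g(x) D xᵀ - G(x) - F(g(x); ε)` attached to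
`F(·; ε)`, `G`, the matrix `D` and the map `g` of a vector recursion `x ↦ f(g(x); ε)`
in dimension `d`. -/
def vectorPotential {d : ℕ} (D : Matrix (Fin d) (Fin d) ℝ)
    (F : (Fin d → ℝ) → ℝ → ℝ) (G : (Fin d → ℝ) → ℝ) (g : (Fin d → ℝ) → (Fin d → ℝ))
    (x : Fin d → ℝ) (ε : ℝ) : ℝ :=
  (Matrix.vecMul (g x) D) ⬝ᵥ x - G x - F (g x) ε

/-- Density evolution of `(l, r, g)` MN codes, bit-node side:
`f(x; ε) = (x₁^(l-1), ε x₂^(g-1))`. The coordinates `x₁, x₂` are `x 0, x 1`. -/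
def bitMap (l g : ℕ) (x : Fin 2 → ℝ) (ε : ℝ) : Fin 2 → ℝ :=
  ![x 0 ^ (l - 1), ε * x 1 ^ (g - 1)]

/-- Density evolution of `(l, r, g)` MN codes, check-node side:
`g(x) = (1 - (1-x₁)^(r-1) (1-x₂)^g, 1 - (1-x₁)^r (1-x₂)^(g-1))`. -/
def checkMap (r g : ℕ) (x : Fin 2 → ℝ) : Fin 2 → ℝ :=
  ![1 - (1 - x 0) ^ (r - 1) * (1 - x 1) ^ g, 1 - (1 - x 0) ^ r * (1 - x 1) ^ (g - 1)]

/-- `F(x; ε) = (r/l) x₁^l + ε x₂^g`. -/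
def bitFunctional (l r g : ℕ) (x : Fin 2 → ℝ) (ε : ℝ) : ℝ :=
  (r : ℝ) / (l : ℝ) * x 0 ^ l + ε * x 1 ^ g

/-- `G(x) = r x₁ + g x₂ + (1-x₁)^r (1-x₂)^g - 1`. -/
def checkFunctional (r g : ℕ) (x : Fin 2 → ℝ) : ℝ :=
  (r : ℝ) * x 0 + (g : ℝ) * x 1 + (1 - x 0) ^ r * (1 - x 1) ^ g - 1

/-- `D = diag(r, g)`. -/
def weightMatrix (r g : ℕ) : Matrix (Fin 2) (Fin 2) ℝ :=
  Matrix.diagonal ![(r : ℝ), (g : ℝ)]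

/-- The potential function `U(x; ε)` of `(l, r, g)` MN codes. -/
def potential (l r g : ℕ) (x : Fin 2 → ℝ) (ε : ℝ) : ℝ :=
  vectorPotential (weightMatrix r g) (bitFunctional l r g) (checkFunctional r g)
    (checkMap r g) x ε

/-- `x ∈ [0,1]²` is a fixed point of the density evolution for the erasure
probability `ε ∈ [0,1]`. -/
def IsFixedPoint (l r g : ℕ) (x : Fin 2 → ℝ) (ε : ℝ) : Prop :=
  (∀ i, x i ∈ Set.Icc (0 : ℝ) 1) ∧ ε ∈ Set.Icc (0 : ℝ) 1 ∧
    x = bitMap l g (checkMap r g x) ε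

/-- A fixed point other than the trivial ones `(0, 0)` and `(1, ε)`. -/
def IsNontrivialFixedPoint (l r g : ℕ) (x : Fin 2 → ℝ) (ε : ℝ) : Prop :=
  IsFixedPoint l r g x ε ∧ x ≠ ![0, 0] ∧ x ≠ ![1, ε]

/-- `x₂(x₁) = 1 - ((1 - x₁^(1/(l-1))) / (1-x₁)^(r-1))^(1/g)`. -/
def fixedPointX2 (l r g : ℕ) (x₁ : ℝ) : ℝ :=
  1 - ((1 - x₁ ^ (1 / ((l : ℝ) - 1))) / (1 - x₁) ^ (r - 1)) ^ (1 / (g : ℝ))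

/-- `ε(x₁) = x₂(x₁) / (1 - (1-x₁)^r (1-x₂(x₁))^(g-1))^(g-1)`. -/
def fixedPointEps (l r g : ℕ) (x₁ : ℝ) : ℝ :=
  fixedPointX2 l r g x₁ /
    (1 - (1 - x₁) ^ r * (1 - fixedPointX2 l r g x₁) ^ (g - 1)) ^ (g - 1)

end MNCode

end

namespace MNCode

/-- A polynomial that is positive on the unit square, because its coefficients in the
Bernstein basis of degree four in `t` are positive on the unit interval. -/
lemma unitSquare_poly_pos {t y : ℝ} (ht0 : 0 ≤ t) (ht1 : t ≤ 1) (hy0 : 0 ≤ y) (hy1 : y ≤ 1) :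
    0 < 1 + t * y * (5 - 23 / 3 * y + 3 * y ^ 2 + 3 * y ^ 3
          - (10 * (t * y ^ 2) - 2 * (t * y ^ 2) ^ 2) * (1 - y / 3))
        + (t * y) ^ 2 * ((1 - 2 / 3 * y - y ^ 2 / 9)
            * (-5 + 2 * (t * y ^ 2) + 3 * (t * y ^ 2) ^ 2)
          + 2 / 9 * y ^ 2 * (49 - 70 * (t * y ^ 2) + 30 * (t * y ^ 2) ^ 2)) := by
  have h1 : 0 < 1 + 5 / 4 * y - 23 / 12 * y ^ 2 + 3 / 4 * y ^ 3 + 3 / 4 * y ^ 4 := by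
    nlinarith [mul_nonneg hy0 (sq_nonneg (y - 1)), sq_nonneg (y - 1), sq_nonneg (y ^ 2 - y)]
  have h2 : 0 < 1 + 5 / 2 * y - 14 / 3 * y ^ 2 + 7 / 18 * y ^ 3 + 107 / 27 * y ^ 4 := by
    nlinarith [mul_nonneg hy0 (sq_nonneg (y - 1)), sq_nonneg (y - 1), sq_nonneg (y ^ 2 - y),
      sq_nonneg (y ^ 2 - 1 / 2), mul_nonneg hy0 (sub_nonneg.2 hy1)]
  have h3 : 0 < 1 + 15 / 4 * y - 33 / 4 * y ^ 2 - 13 / 12 * y ^ 3 + 365 / 36 * y ^ 4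
      + 1 / 6 * y ^ 5 - 37 / 9 * y ^ 6 := by
    have h6 : y ^ 6 ≤ y ^ 5 := pow_le_pow_of_le_one hy0 hy1 (by norm_num)
    have h5 : y ^ 5 ≤ y ^ 4 := pow_le_pow_of_le_one hy0 hy1 (by norm_num)
    nlinarith [mul_nonneg hy0 (sq_nonneg (y - 1)), sq_nonneg (y - 1), sq_nonneg (y ^ 2 - y),
      sq_nonneg (y ^ 2 - 1 / 2), mul_nonneg hy0 (sub_nonneg.2 hy1)]
  have h4 : 0 < 1 + 5 * y - 38 / 3 * y ^ 2 - 11 / 3 * y ^ 3 + 178 / 9 * y ^ 4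
      + 2 / 3 * y ^ 5 - 121 / 9 * y ^ 6 - 2 * y ^ 7 + 19 / 3 * y ^ 8 := by
    have h : 0 ≤ y * (1 - y) := mul_nonneg hy0 (sub_nonneg.2 hy1)
    nlinarith [sq_nonneg (y ^ 2 - 5 / 8), sq_nonneg (y ^ 3 - 5 / 8 * y),
      sq_nonneg (y ^ 4 - 5 / 8 * y ^ 2), sq_nonneg (y ^ 4 - 2 * y ^ 2 + 3 / 5),
      mul_nonneg h (sq_nonneg (y ^ 2 - 5 / 8)), mul_nonneg h (sq_nonneg (y ^ 3 - 5 / 8 * y)),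
      mul_nonneg hy0 (sq_nonneg (y - 4 / 5)), mul_nonneg hy0 (sq_nonneg (y ^ 2 - 5 / 8)),
      mul_nonneg hy0 (sq_nonneg (y ^ 3 - 5 / 8 * y))]
  have hs : 0 ≤ 1 - t := sub_nonneg.2 ht1
  have key : 0 < (1 - t) ^ 4
      + 4 * t * (1 - t) ^ 3
        * (1 + 5 / 4 * y - 23 / 12 * y ^ 2 + 3 / 4 * y ^ 3 + 3 / 4 * y ^ 4)
      + 6 * t ^ 2 * (1 - t) ^ 2
        * (1 + 5 / 2 * y - 14 / 3 * y ^ 2 + 7 / 18 * y ^ 3 + 107 / 27 * y ^ 4)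
      + 4 * t ^ 3 * (1 - t)
        * (1 + 15 / 4 * y - 33 / 4 * y ^ 2 - 13 / 12 * y ^ 3 + 365 / 36 * y ^ 4
          + 1 / 6 * y ^ 5 - 37 / 9 * y ^ 6)
      + t ^ 4 * (1 + 5 * y - 38 / 3 * y ^ 2 - 11 / 3 * y ^ 3 + 178 / 9 * y ^ 4
          + 2 / 3 * y ^ 5 - 121 / 9 * y ^ 6 - 2 * y ^ 7 + 19 / 3 * y ^ 8) := by
    rcases ht0.eq_or_lt with rfl | ht
    · norm_num
    · positivity
  linarith [key]

lemma envelope_pos {x y : ℝ} (hx : 0 ≤ x) (hxy : x ≤ y ^ 2) (hy0 : 0 < y) (hy1 : y ≤ 1) :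
    0 < (1 - (1 - x) ^ 2 * (1 - x / 3) * (1 - y / 3)) ^ 2
      - (1 - 2 / 3 * x) * (1 - 2 / 3 * y - y ^ 2 / 9) * x ^ 2 * (6 - 4 * x + x ^ 2)
      - x * y * (1 + (y - y ^ 2 - y ^ 3) / 3) := by
  obtain ⟨t, rfl⟩ : ∃ t, x = t * y ^ 2 := ⟨x / y ^ 2, by field_simp⟩
  have hy2 : 0 < y ^ 2 := by positivity
  have ht0 : 0 ≤ t := nonneg_of_mul_nonneg_left hx hy2
  have ht1 : t ≤ 1 := by nlinarith
  have hx1 : t * y ^ 2 ≤ 1 := by nlinarith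
  have h := unitSquare_poly_pos ht0 ht1 hy0.le hy1
  have hB : 0 ≤ 1 - 2 / 3 * y - y ^ 2 / 9 := by nlinarith
  have h1 : 0 ≤ (1 - 2 / 3 * y - y ^ 2 / 9)
      * ((t * y ^ 2) ^ 2 * ((1 - t * y ^ 2) * (3 - t * y ^ 2))) :=
    mul_nonneg hB (mul_nonneg (sq_nonneg _) (mul_nonneg (by linarith) (by linarith)))
  have h2 : 0 ≤ 2 / 9 * y ^ 2
      * ((t * y ^ 2) ^ 2 * ((1 - t * y ^ 2) * (9 - t * y ^ 2))) :=
    mul_nonneg (by positivity) (mul_nonneg (sq_nonneg _) (mul_nonneg (by linarith) (by linarith)))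
  have h3 := mul_nonneg (sq_nonneg (t * y)) (add_nonneg h1 h2)
  have h4 := mul_pos hy2 (add_pos_of_pos_of_nonneg h h3)
  linarith [h4]

lemma two_mul_one_sub_pow_le {y : ℝ} (hy0 : 0 ≤ y) (hy1 : y ≤ 1) {n : ℕ} (hn : 2 ≤ n) :
    2 * (1 - y ^ n) ≤ n * (1 - y ^ 2) := by
  induction n, hn using Nat.le_induction with
  | base => norm_num
  | succ n hn ih =>
    have h : y ^ n ≤ y ^ 2 := pow_le_pow_of_le_one hy0 hy1 hn
    have h' : y ^ n * (1 - y) ≤ y ^ 2 * (1 - y) :=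
      mul_le_mul_of_nonneg_right h (sub_nonneg.2 hy1)
    push_cast
    rw [pow_succ y n]
    nlinarith [mul_nonneg (sub_nonneg.2 hy1) (sub_nonneg.2 hy1)]

lemma le_of_cube_le {u v : ℝ} (hv : 0 ≤ v) (h : u ^ 3 ≤ v ^ 3) : u ≤ v :=
  le_of_pow_le_pow_left₀ (by norm_num) hv h

lemma three_mul_sq_le {m x y p β : ℝ} (hm : 0 ≤ m) (hx1 : x ≤ 1) (hy1 : y ≤ 1)
    (hβ : 0 ≤ β) (hq : 0 ≤ 1 + (y - y ^ 2 - y ^ 3) / 3)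
    (hpx : p ^ 3 = 1 - x) (hβy : β ^ 3 = 1 - y) (hS : 2 * (1 - x) ≤ m * (1 - y ^ 2)) :
    3 * p ^ 2 ≤ (m + 1) * (β * (1 + (y - y ^ 2 - y ^ 3) / 3)) := by
  refine le_of_cube_le (by positivity) ?_
  have e1 : (3 * p ^ 2) ^ 3 = 27 * (1 - x) ^ 2 := by rw [← hpx]; ring
  have e2 : ((m + 1) * (β * (1 + (y - y ^ 2 - y ^ 3) / 3))) ^ 3
      = (m + 1) ^ 3 * ((1 - y) * (1 + (y - y ^ 2 - y ^ 3) / 3) ^ 3) := by rw [← hβy]; ring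
  rw [e1, e2]
  have i1 : (2 * (1 - x)) ^ 2 ≤ (m * (1 - y ^ 2)) ^ 2 :=
    pow_le_pow_left₀ (by linarith) hS 2
  have i2 : 27 / 4 * m ^ 2 ≤ (m + 1) ^ 3 := by
    nlinarith [mul_nonneg (sq_nonneg (m - 2)) (by linarith : (0 : ℝ) ≤ m + 1 / 4)]
  have i3 : 1 + 3 * ((y - y ^ 2 - y ^ 3) / 3) ≤ (1 + (y - y ^ 2 - y ^ 3) / 3) ^ 3 := by
    clear e2
    generalize (y - y ^ 2 - y ^ 3) / 3 = z at *
    nlinarith [mul_nonneg (sq_nonneg z) (by linarith : (0 : ℝ) ≤ z + 3)]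
  calc 27 * (1 - x) ^ 2 = 27 / 4 * (2 * (1 - x)) ^ 2 := by ring
    _ ≤ 27 / 4 * (m * (1 - y ^ 2)) ^ 2 := by gcongr
    _ = (27 / 4 * m ^ 2) * ((1 - y) * (1 + 3 * ((y - y ^ 2 - y ^ 3) / 3))) := by ring
    _ ≤ (m + 1) ^ 3 * ((1 - y) * (1 + (y - y ^ 2 - y ^ 3) / 3) ^ 3) := by
      have : 0 ≤ 1 - y := by linarith
      have : 0 ≤ 1 + 3 * ((y - y ^ 2 - y ^ 3) / 3) := by
        linarith [mul_nonneg (sq_nonneg (1 + y)) this]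
      gcongr

/-- The potential along the curve of fixed points, with `x = x₁`, `y = x₁^(1/n)`, `n = l - 1`
and `b = 1 - x₂`, is positive. -/
lemma curve_pos {n : ℕ} (hn : 2 ≤ n) {y b : ℝ} (hy0 : 0 < y) (hy1 : y < 1) (hb : 0 < b)
    (hbc : b ^ 3 * (1 - y ^ n) ^ 2 = 1 - y) :
    0 < b + (1 - y) * (1 - 4 * y ^ n) - 2 * (1 - y ^ n) ^ 3 * b ^ 2
      - 3 / ((n : ℝ) + 1) * (y ^ n * y) := by
  have hS := two_mul_one_sub_pow_le hy0.le hy1.le hn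
  have hxy : y ^ n ≤ y ^ 2 := pow_le_pow_of_le_one hy0.le hy1.le hn
  have hx0 : 0 < y ^ n := by positivity
  have hx1 : y ^ n < 1 := pow_lt_one₀ hy0.le hy1 (by omega)
  have hn' : (2 : ℝ) ≤ n := by exact_mod_cast hn
  generalize y ^ n = x at *
  generalize (n : ℝ) = m at *
  obtain ⟨p, hp, hpx⟩ : ∃ p : ℝ, 0 < p ∧ p ^ 3 = 1 - x :=
    ⟨(1 - x) ^ ((1 : ℝ) / 3), Real.rpow_pos_of_pos (by linarith) _, by
      rw [← Real.rpow_natCast, ← Real.rpow_mul (by linarith)]; norm_num⟩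
  set β := b * p ^ 2 with hβ
  have hβ0 : 0 < β := by positivity
  have hβy : β ^ 3 = 1 - y := by rw [← hbc, ← hpx, hβ]; ring
  have hp1 : p ≤ 1 - x / 3 := le_of_cube_le (by linarith) (by
    rw [hpx]; nlinarith [mul_nonneg (sq_nonneg x) (sub_nonneg.2 hx1.le), sq_nonneg x])
  have hp2 : p ^ 2 ≤ 1 - 2 / 3 * x := le_of_cube_le (by linarith) (by
    rw [← pow_mul, mul_comm, pow_mul, hpx]
    nlinarith [mul_nonneg (sq_nonneg x) (sub_nonneg.2 hx1.le), sq_nonneg x])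
  have hβ1 : β ≤ 1 - y / 3 := le_of_cube_le (by linarith) (by
    rw [hβy]; nlinarith [mul_nonneg (sq_nonneg y) (sub_nonneg.2 hy1.le), sq_nonneg y])
  have hβ2 : β ^ 2 ≤ 1 - 2 / 3 * y - y ^ 2 / 9 := le_of_cube_le (by nlinarith) (by
    rw [← pow_mul, mul_comm, pow_mul, hβy]
    have hy3 : 0 ≤ y ^ 3 := by positivity
    nlinarith [mul_nonneg hy3 (sub_nonneg.2 hy1.le), mul_nonneg (mul_nonneg hy3 hy0.le)
      (sub_nonneg.2 hy1.le), mul_nonneg (mul_nonneg hy3 (sq_nonneg y)) (sub_nonneg.2 hy1.le)])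
  have hq : 0 < 1 + (y - y ^ 2 - y ^ 3) / 3 := by
    nlinarith [mul_pos hy0 (sub_pos.2 hy1), mul_pos (mul_pos hy0 hy0) (sub_pos.2 hy1)]
  have hT := three_mul_sq_le (by linarith) hx1.le hy1.le hβ0.le hq.le hpx hβy hS
  have hR := envelope_pos hx0.le hxy hy0 hy1.le
  have j1 : p * β ≤ (1 - x / 3) * (1 - y / 3) := mul_le_mul hp1 hβ1 hβ0.le (by linarith)
  have j2 : p ^ 2 * β ^ 2 ≤ (1 - 2 / 3 * x) * (1 - 2 / 3 * y - y ^ 2 / 9) :=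
    mul_le_mul hp2 hβ2 (by positivity) (by linarith)
  have j3 : (1 - x) ^ 2 * (p * β) ≤ (1 - x) ^ 2 * ((1 - x / 3) * (1 - y / 3)) := by gcongr
  have j4 : (1 - x) ^ 2 * ((1 - x / 3) * (1 - y / 3)) ≤ 1 := by
    have := mul_le_one₀ (by linarith : 1 - x / 3 ≤ 1) (by linarith) (by linarith : 1 - y / 3 ≤ 1)
    exact mul_le_one₀ (pow_le_one₀ (by linarith) (by linarith))
      (mul_nonneg (by linarith) (by linarith)) this
  have j5 : (1 - (1 - x) ^ 2 * ((1 - x / 3) * (1 - y / 3))) ^ 2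
      ≤ (1 - (1 - x) ^ 2 * (p * β)) ^ 2 := pow_le_pow_left₀ (by linarith) (by linarith) 2
  have j6 : p ^ 2 * β ^ 2 * (x ^ 2 * (6 - 4 * x + x ^ 2))
      ≤ (1 - 2 / 3 * x) * (1 - 2 / 3 * y - y ^ 2 / 9) * (x ^ 2 * (6 - 4 * x + x ^ 2)) :=
    mul_le_mul_of_nonneg_right j2 (mul_nonneg (sq_nonneg x) (by nlinarith))
  have hW : 0 < (1 - (1 - x) ^ 2 * (p * β)) ^ 2
      - p ^ 2 * β ^ 2 * (x ^ 2 * (6 - 4 * x + x ^ 2))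
      - x * y * (1 + (y - y ^ 2 - y ^ 3) / 3) := by
    linarith
  have hT' : 3 / (m + 1) ≤ b * (1 + (y - y ^ 2 - y ^ 3) / 3) := by
    rw [div_le_iff₀ (by linarith)]
    refine le_of_mul_le_mul_right (a := p ^ 2) ?_ (by positivity)
    calc 3 * p ^ 2 ≤ _ := hT
      _ = _ := by rw [hβ]; ring
  have hT2 : 3 / (m + 1) * (x * y) ≤ b * (1 + (y - y ^ 2 - y ^ 3) / 3) * (x * y) := by gcongr
  have hbW := mul_pos hb hW
  have e : b * ((1 - (1 - x) ^ 2 * (p * β)) ^ 2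
      - p ^ 2 * β ^ 2 * (x ^ 2 * (6 - 4 * x + x ^ 2))
      - x * y * (1 + (y - y ^ 2 - y ^ 3) / 3))
      = b + (1 - y) * (1 - 4 * x) - 2 * (1 - x) ^ 3 * b ^ 2
        - b * (1 + (y - y ^ 2 - y ^ 3) / 3) * (x * y) := by
    have k1 : p * β = b * (1 - x) := by rw [hβ, ← hpx]; ring
    rw [← mul_pow, k1, ← hbc]
    ring
  linarith

/-- At a point satisfying the fixed point equations the potential takes the form bounded in
`curve_pos`. -/
lemma potential_pos_of_eq {l : ℕ} (hl : 3 ≤ l) {x₁ x₂ ε y : ℝ} (hy0 : 0 < y) (hy1 : y < 1)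
    (hx₂ : x₂ < 1) (hyx : y ^ (l - 1) = x₁) (hc : 1 - (1 - x₁) ^ 2 * (1 - x₂) ^ 3 = y)
    (hε : ε * (1 - (1 - x₁) ^ 3 * (1 - x₂) ^ 2) ^ 2 = x₂) :
    0 < potential l 3 3 ![x₁, x₂] ε := by
  obtain ⟨n, rfl⟩ : ∃ n, l = n + 1 := ⟨l - 1, by omega⟩
  rw [Nat.add_sub_cancel] at hyx
  have h := curve_pos (n := n) (by omega) hy0 hy1 (sub_pos.2 hx₂) (by rw [hyx]; linarith)
  have hn : ((n : ℝ) + 1) ≠ 0 := by positivity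
  have e : potential (n + 1) 3 3 ![x₁, x₂] ε
      = (1 - x₂) + (1 - y) * (1 - 4 * y ^ n) - 2 * (1 - y ^ n) ^ 3 * (1 - x₂) ^ 2
        - 3 / ((n : ℝ) + 1) * (y ^ n * y) := by
    simp only [potential, vectorPotential, weightMatrix, bitFunctional, checkFunctional,
      checkMap, Matrix.vecMul_diagonal, dotProduct, Fin.sum_univ_two, Matrix.cons_val_zero,
      Matrix.cons_val_one]
    norm_num only
    have hc' : (1 - x₁) ^ 2 * (1 - x₂) ^ 3 = 1 - y := by linarith
    rw [hc, pow_succ y n, hyx]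
    set z := 1 - (1 - x₁) ^ 3 * (1 - x₂) ^ 2 with hz
    have hz3 : ε * z ^ 3 = x₂ * z := by rw [← hε]; ring
    rw [hz3, hz]
    push_cast
    linear_combination (1 - x₁) * hc'
  rw [e]
  exact h

lemma exists_root_of_fixedPointX2 {l : ℕ} (hl : 3 ≤ l) {x₁ : ℝ} (h0 : 0 < x₁) (h1 : x₁ < 1) :
    ∃ y : ℝ, 0 < y ∧ y < 1 ∧ y ^ (l - 1) = x₁ ∧ fixedPointX2 l 3 3 x₁ < 1 ∧
      1 - (1 - x₁) ^ 2 * (1 - fixedPointX2 l 3 3 x₁) ^ 3 = y := by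
  have hl' : (0 : ℝ) < (l : ℝ) - 1 := by
    have : (3 : ℝ) ≤ l := by exact_mod_cast hl
    linarith
  have hy1 : x₁ ^ (1 / ((l : ℝ) - 1)) < 1 := Real.rpow_lt_one h0.le h1 (by positivity)
  have ha : 0 < 1 - x₁ := by linarith
  have hq : 0 < (1 - x₁ ^ (1 / ((l : ℝ) - 1))) / (1 - x₁) ^ 2 :=
    div_pos (by linarith) (by positivity)
  refine ⟨x₁ ^ (1 / ((l : ℝ) - 1)), Real.rpow_pos_of_pos h0 _, hy1, ?_, ?_, ?_⟩
  · rw [← Real.rpow_natCast, ← Real.rpow_mul h0.le, Nat.cast_sub (by omega), Nat.cast_one,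
      one_div_mul_cancel hl'.ne', Real.rpow_one]
  · exact sub_lt_self _ (Real.rpow_pos_of_pos hq _)
  · have : (1 - fixedPointX2 l 3 3 x₁) ^ 3
        = (1 - x₁ ^ (1 / ((l : ℝ) - 1))) / (1 - x₁) ^ 2 := by
      rw [fixedPointX2, sub_sub_cancel, ← Real.rpow_natCast, ← Real.rpow_mul hq.le]
      norm_num
    rw [this]
    field_simp
    ring

lemma curve_potential_pos {l : ℕ} (hl : 3 ≤ l) {x₁ : ℝ} (h0 : 0 < x₁) (h1 : x₁ < 1) :
    0 < potential l 3 3 ![x₁, fixedPointX2 l 3 3 x₁] (fixedPointEps l 3 3 x₁) := by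
  obtain ⟨y, hy0, hy1, hyx, hx₂, hc⟩ := exists_root_of_fixedPointX2 hl h0 h1
  refine potential_pos_of_eq hl hy0 hy1 hx₂ hyx hc ?_
  rw [fixedPointEps]
  refine div_mul_cancel₀ _ (pow_ne_zero _ ?_)
  set b := 1 - fixedPointX2 l 3 3 x₁ with hb
  have ha0 : 0 < 1 - x₁ := by linarith
  have hb0 : 0 < b := by linarith
  have hlt : ((1 - x₁) ^ 3 * b ^ 2) ^ 3 < 1 := by
    have e : ((1 - x₁) ^ 3 * b ^ 2) ^ 3 = (1 - x₁) ^ 5 * (1 - y) ^ 2 := by rw [← hc]; ring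
    rw [e]
    exact mul_lt_one_of_nonneg_of_lt_one_left (by positivity)
      (pow_lt_one₀ ha0.le (by linarith) (by norm_num)) (pow_le_one₀ (by linarith) (by linarith))
  have := lt_of_pow_lt_pow_left₀ 3 zero_le_one (hlt.trans_eq (one_pow 3).symm)
  exact (sub_pos.2 this).ne'

lemma nontrivialFixedPoint_potential_pos {l : ℕ} (hl : 3 ≤ l) {x : Fin 2 → ℝ} {ε : ℝ}
    (h : IsNontrivialFixedPoint l 3 3 x ε) : 0 < potential l 3 3 x ε := by
  obtain ⟨⟨hx, -, hfix⟩, hne0, hne1⟩ := h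
  have hv : x = ![x 0, x 1] := by ext i; fin_cases i <;> rfl
  have e0 : x 0 = (1 - (1 - x 0) ^ 2 * (1 - x 1) ^ 3) ^ (l - 1) := congrFun hfix 0
  have e1 : x 1 = ε * (1 - (1 - x 0) ^ 3 * (1 - x 1) ^ 2) ^ 2 := congrFun hfix 1
  obtain ⟨h00, h01⟩ := hx 0
  obtain ⟨h10, h11⟩ := hx 1
  rw [hv] at hne0 hne1 ⊢
  generalize x 0 = x₁ at *
  generalize x 1 = x₂ at *
  have hl0 : l - 1 ≠ 0 := by omega
  have hy0 : 0 ≤ 1 - (1 - x₁) ^ 2 * (1 - x₂) ^ 3 :=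
    sub_nonneg.2 (mul_le_one₀ (pow_le_one₀ (by linarith) (by linarith))
      (pow_nonneg (by linarith) _) (pow_le_one₀ (by linarith) (by linarith)))
  have hx₁0 : x₁ ≠ 0 := by
    rintro rfl
    have := pow_eq_zero_iff hl0 |>.1 e0.symm
    have h1 : (1 - x₂) ^ 3 = 1 := by linarith
    have : x₂ = 0 := by
      have := (pow_eq_one_iff_of_nonneg (by linarith : 0 ≤ 1 - x₂) (by norm_num)).1 h1
      linarith
    exact hne0 (by rw [this])
  have hx₁1 : x₁ ≠ 1 := by
    rintro rfl
    exact hne1 (by rw [e1]; norm_num)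
  have hx₁ : 0 < x₁ := lt_of_le_of_ne h00 hx₁0.symm
  have hx₁' : x₁ < 1 := lt_of_le_of_ne h01 hx₁1
  have hy : 0 < 1 - (1 - x₁) ^ 2 * (1 - x₂) ^ 3 := by
    refine lt_of_le_of_ne hy0 fun h => hx₁0 ?_
    rw [e0, ← h, zero_pow hl0]
  have hy1 : 1 - (1 - x₁) ^ 2 * (1 - x₂) ^ 3 < 1 := by
    refine lt_of_le_of_ne ?_ fun h => hx₁1 ?_
    · have : 0 ≤ (1 - x₁) ^ 2 * (1 - x₂) ^ 3 :=
        mul_nonneg (sq_nonneg _) (pow_nonneg (by linarith) _)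
      linarith
    · rw [e0, h, one_pow]
  have hx₂ : x₂ < 1 := by
    refine lt_of_le_of_ne h11 ?_
    rintro rfl
    norm_num at hy1
  exact potential_pos_of_eq hl hy hy1 hx₂ e0.symm rfl e1.symm

end MNCode

theorem mainTheorem2 (l : ℕ) (hl : 3 ≤ l) :
    (∀ x₁ ∈ Set.Ioo (0 : ℝ) 1,
      0 < MNCode.potential l 3 3 ![x₁, MNCode.fixedPointX2 l 3 3 x₁]
        (MNCode.fixedPointEps l 3 3 x₁)) ∧
    (∀ (x : Fin 2 → ℝ) (ε : ℝ), MNCode.IsNontrivialFixedPoint l 3 3 x ε →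
      0 < MNCode.potential l 3 3 x ε) :=
  ⟨fun _ hx => MNCode.curve_potential_pos hl hx.1 hx.2,
    fun _ _ h => MNCode.nontrivialFixedPoint_potential_pos hl h⟩
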